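/- A pure $(n,1)$ quantum strategy consists of pure qubit states $E(x)\in\mathbb{C}^2$ for $x\in\{0,1\}^n$ and of orthonormal bases $M_i=\{\psi^i_0,\psi^i_1\}$ of $\mathbb{C}^2$ for $1\le i\le n$. On input $(x,i)$ it recovers the bit $x_i$ with probability $|\langle\psi^i_{x_i}|E(x)\rangle|^2$. Its encoding is optimal for its measurements if no other encoding, used with the same measurements, has a larger average success probability over the $2^n n$ inputs $(x,i)$. The direction of $M_i$ is the Bloch vector of $\psi^i_0$, a unit vector of $\mathbb{R}^3$. A quantum strategy (an $(n,1)$ QRAC) with shared randomness is a probability distribution over pure strategies. Theorem. For every $n$ there is an $(n,1)$ QRAC with shared randomness $R_n$ under which the $n$ measurement directions are independent and uniformly distributed on the unit sphere of $\mathbb{R}^3$, and the encoding is almost surely optimal for the measurements, such that the following hold. Let $$d_n=\mathbb{E}\,\Bigl\|\sum_{i=1}^n v_i\Bigr\|,\qquad v_1,\dots,v_n \text{ independent and uniform on the unit sphere of } \mathbb{R}^3,$$ be the mean distance from the origin of an $n$-step random walk with unit steps. (i) For every $n\ge 1$, the worst case success probability $p_n$ of $R_n$ over all inputs $(x,i)$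 equals its expected average success probability, and $$p_n=\frac12\Bigl(1+\frac{d_n}{n}\Bigr).$$ (ii) As $n\to\infty$, $$d_n\sim 2\sqrt{\frac{2n}{3\pi}}\qquad\text{and}\qquad p_n-\frac12\sim\sqrt{\frac{2}{3\pi n}},$$ where $a_n\sim b_n$ means $a_n/b_n\to1$. -/

import Mathlib

open MeasureTheory Filter

noncomputable section

namespace QRAC

/-- The state space `ℂ²` of a qubit; pure states are its unit vectors. -/
abbrev Qubit : Type := EuclideanSpace ℂ (Fin 2)

/-- The space `ℝ³` that contains the Bloch sphere. -/
abbrev Space : Type := EuclideanSpace ℝ (Fin 3)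

/-- The Bloch vector of a pure state `ψ = α|0⟩ + β|1⟩`, i.e. the vector `r = (x, y, z)` with
`|ψ⟩⟨ψ| = (I + x σ_x + y σ_y + z σ_z) / 2`. -/
def bloch (ψ : Qubit) : Space :=
  !₂[2 * (starRingEnd ℂ (ψ 0) * ψ 1).re, 2 * (starRingEnd ℂ (ψ 0) * ψ 1).im,
    ‖ψ 0‖ ^ 2 - ‖ψ 1‖ ^ 2]

/-- A pure quantum encoding-decoding strategy for `n` bits and one qubit: every string
`x : Fin n → Bool` is encoded into a pure state, and the `i`-th bit is decoded with the orthogonal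
measurement `{meas i false, meas i true}` (`false` is the bit `0`, `true` is the bit `1`). -/
structure PureStrategy (n : ℕ) where
  enc : (Fin n → Bool) → Qubit
  meas : Fin n → Bool → Qubit
  norm_enc : ∀ x, ‖enc x‖ = 1
  orthonormal_meas : ∀ i, Orthonormal ℂ (meas i)

/-- The Borel structure on pure strategies, as a subset of a finite-dimensional vector space. -/
instance (n : ℕ) : MeasurableSpace (PureStrategy n) :=
  MeasurableSpace.comap (fun s => (s.enc, s.meas)) inferInstance

namespace PureStrategy

variable {n : ℕ}

/-- The probability `p(x, i) = |⟨ψ^i_{x_i}|E(x)⟩|²` that the `i`-th bit of `x` is recovered. -/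
def successProb (s : PureStrategy n) (x : Fin n → Bool) (i : Fin n) : ℝ :=
  ‖inner ℂ (s.meas i (x i)) (s.enc x)‖ ^ 2

/-- The average success probability over the `2ⁿ n` inputs `(x, i)`. -/
def averageSuccess (s : PureStrategy n) : ℝ :=
  (1 / (2 ^ n * (n : ℝ))) * ∑ x : Fin n → Bool, ∑ i : Fin n, s.successProb x i

/-- The encoding is optimal for the measurements: no other encoding used with the same measurements
has a larger average success probability. -/
def HasOptimalEncoding (s : PureStrategy n) : Prop :=
  ∀ t : PureStrategy n, t.meas = s.meas → t.averageSuccess ≤ s.averageSuccess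

/-- The measurement direction for the `i`-th bit: the Bloch vector of the state for outcome `0`.
The state for outcome `1` is orthogonal to it and has the opposite Bloch vector. -/
def direction (s : PureStrategy n) (i : Fin n) : Space :=
  bloch (s.meas i false)

end PureStrategy

/-- A quantum strategy with shared randomness: a probability distribution over pure strategies. -/
abbrev SharedStrategy (n : ℕ) : Type := ProbabilityMeasure (PureStrategy n)

namespace SharedStrategy

variable {n : ℕ}

/-- The probability that the `i`-th bit of `x` is recovered. -/
def successProb (R : SharedStrategy n) (x : Fin n → Bool) (i : Fin n) : ℝ :=
  ∫ s, s.successProb x i ∂(R : Measure (PureStrategy n))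

/-- The worst case success probability, over all inputs `(x, i)`. -/
def worstCaseSuccess (R : SharedStrategy n) : ℝ :=
  ⨅ q : (Fin n → Bool) × Fin n, successProb R q.1 q.2

/-- The expectation, over the shared randomness, of the average success probability of the pure
strategy that is used. -/
def expectedSuccess (R : SharedStrategy n) : ℝ :=
  ∫ s, s.averageSuccess ∂(R : Measure (PureStrategy n))

end SharedStrategy

/-- The uniform probability distribution on the unit sphere of `ℝ³`: normalized surface measure. -/
def uniformSphere : Measure Space :=
  ((volume : Measure Space).toSphere Set.univ)⁻¹ •
    ((volume : Measure Space).toSphere).map Subtype.val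

/-- The law of `n` independent uniformly random unit vectors of `ℝ³`. -/
def uniformDirections (n : ℕ) : Measure (Fin n → Space) :=
  Measure.pi fun _ => uniformSphere

/-- The mean distance `E ‖v₁ + ⋯ + vₙ‖` from the origin after `n` unit steps of a random walk in
`ℝ³`, whose directions are independent and uniformly random. -/
def meanDistance (n : ℕ) : ℝ :=
  ∫ v, ‖∑ i, v i‖ ∂uniformDirections n

/-- The strategy measures in independent uniformly random directions and encodes optimally for
them. -/
structure SharedStrategy.IsRandomMeasurement {n : ℕ} (R : SharedStrategy n) : Prop where
  map_direction :
    (R : Measure (PureStrategy n)).map PureStrategy.direction = uniformDirections n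
  optimal : ∀ᵐ s ∂(R : Measure (PureStrategy n)), s.HasOptimalEncoding

end QRAC

end

/-! In Bloch coordinates a bit is recovered with probability `(1 + ⟨b, r⟩) / 2`, where `b` belongs
to the correct outcome and `r` to the encoding; opposite outcomes have opposite vectors. For fixed
`x`, the sum over `i` depends on `r` only through its inner product with the signed sum of the
directions, so by Cauchy–Schwarz it is best to point `r` along that sum
(`PureStrategy.hasOptimalEncoding_of_inner`). The law of the directions is invariant under sign
flips and permutations, so all inputs succeed equally often (`successProb_randomStrategy`,
`meanComponent_eq`). Hence worst case and average agree, and averaging over `i` produces `d_n / n`.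

For the growth of `d_n`, a coordinate of a uniform direction has mean absolute value `1/2`, so `d_n`
is twice the mean of `|∑ v_i 0|` (`meanDistance_eq_two_mul`). This is a walk on the line with step
variance `1/3`, to which the central limit theorem applies. Bounded second moments upgrade weak
convergence to convergence of first absolute moments (`tendsto_integral_abs`), and the Gaussian
value `√(2/π)` gives the constant. -/

noncomputable section

namespace QRAC

/-! ### The uniform measure on the sphere and its symmetries -/

open scoped Pointwise in
/-- The surface measure of the unit sphere is invariant under linear isometries. -/
lemma map_toSphere_linearIsometryEquiv (L : Space ≃ₗᵢ[ℝ] Space) :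
    (((volume : Measure Space).toSphere).map Subtype.val).map L =
      ((volume : Measure Space).toSphere).map Subtype.val := by
  ext s hs
  have hL : Measurable L := L.continuous.measurable
  -- Surface measure is three times the volume of the cone over a set; an isometry maps cones to
  -- cones and preserves volume.
  have key (t : Set Space) (ht : MeasurableSet t) :
      ((volume : Measure Space).toSphere).map Subtype.val t =
        3 * volume (Set.Ioo (0 : ℝ) 1 • (Metric.sphere (0 : Space) 1 ∩ t)) := by
    rw [Measure.map_apply measurable_subtype_coe ht,
      Measure.toSphere_apply' _ (measurable_subtype_coe ht), Subtype.image_preimage_coe]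
    simp
  rw [Measure.map_apply hL hs, key _ (hL hs), key _ hs]
  congr 1
  rw [← L.measurePreserving.measure_preimage_emb L.toHomeomorph.measurableEmbedding
    (Set.Ioo (0 : ℝ) 1 • (Metric.sphere (0 : Space) 1 ∩ s))]
  congr 1
  ext x
  simp only [Set.mem_smul, Set.mem_inter_iff, Set.mem_preimage, mem_sphere_zero_iff_norm]
  constructor
  · rintro ⟨r, hr, y, ⟨hy, hys⟩, rfl⟩
    exact ⟨r, hr, L y, ⟨by simpa using hy, hys⟩, by simp⟩
  · rintro ⟨r, hr, y, ⟨hy, hys⟩, hxy⟩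
    exact ⟨r, hr, L.symm y, ⟨by simpa using hy, by simpa using hys⟩, L.injective (by simp [hxy])⟩

instance : IsProbabilityMeasure uniformSphere where
  measure_univ := by
    rw [uniformSphere, Measure.smul_apply, Measure.map_apply measurable_subtype_coe .univ,
      Set.preimage_univ, smul_eq_mul]
    exact ENNReal.inv_mul_cancel (by simp [Real.pi_pos]) (measure_ne_top _ _)

instance (n : ℕ) : IsProbabilityMeasure (uniformDirections n) := by
  unfold uniformDirections; infer_instance

lemma ae_norm_eq_one : ∀ᵐ u ∂uniformSphere, ‖u‖ = 1 := by
  refine Measure.ae_smul_measure ?_ _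
  rw [ae_map_iff measurable_subtype_coe.aemeasurable (measurableSet_eq_fun (by fun_prop) (by fun_prop))]
  exact ae_of_all _ fun u => by simp

lemma ae_norm_directions_eq_one (n : ℕ) : ∀ᵐ v ∂uniformDirections n, ∀ i, ‖v i‖ = 1 :=
  ae_all_iff.2 fun i =>
    (measurePreserving_eval (fun _ : Fin n => uniformSphere) i).quasiMeasurePreserving.ae
      ae_norm_eq_one

lemma measurePreserving_uniformSphere (L : Space ≃ₗᵢ[ℝ] Space) :
    MeasurePreserving L uniformSphere uniformSphere where
  measurable := L.continuous.measurable
  map_eq := by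
    rw [uniformSphere, Measure.map_smul, map_toSphere_linearIsometryEquiv]

lemma measurePreserving_uniformDirections {n : ℕ} (L : Fin n → Space ≃ₗᵢ[ℝ] Space) :
    MeasurePreserving (fun v i => L i (v i)) (uniformDirections n) (uniformDirections n) :=
  measurePreserving_pi _ _ fun i => measurePreserving_uniformSphere (L i)

lemma measurePreserving_uniformDirections_perm {n : ℕ} (e : Equiv.Perm (Fin n)) :
    MeasurePreserving (fun v i => v (e i)) (uniformDirections n) (uniformDirections n) := by
  have := measurePreserving_piCongrLeft (α := fun _ : Fin n => Space)
    (fun _ : Fin n => uniformSphere) e.symm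
  unfold uniformDirections
  convert this using 1
  ext v i : 2
  have h := Equiv.piCongrLeft_apply_apply (fun _ : Fin n => Space) e.symm v (e i)
  simp only [Equiv.symm_apply_apply] at h
  exact h.symm

/-- The linear isometries of `ℝ³` act transitively on spheres. -/
lemma exists_linearIsometryEquiv_map_eq {x y : Space} (h : ‖x‖ = ‖y‖) :
    ∃ L : Space ≃ₗᵢ[ℝ] Space, L x = y :=
  ⟨_, Submodule.reflection_sub h⟩

/-! ### Moments of one coordinate of a uniform direction -/

/-- The first vector of the standard basis of `ℝ³`. -/
abbrev e₀ : Space := EuclideanSpace.single 0 1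

lemma inner_e₀ (x : Space) : inner ℝ x e₀ = x 0 := by
  simp [EuclideanSpace.inner_single_right]

lemma integrable_uniformSphere {f : Space → ℝ} (hf : Continuous f) : Integrable f uniformSphere := by
  obtain ⟨C, hC⟩ := (isCompact_sphere (0 : Space) 1).exists_bound_of_continuousOn hf.continuousOn
  refine Integrable.of_bound hf.aestronglyMeasurable C ?_
  filter_upwards [ae_norm_eq_one] with u hu
  exact hC u (by simpa using hu)

lemma integral_comp_inner_eq (g : ℝ → ℝ) {x y : Space} (h : ‖x‖ = ‖y‖) :
    ∫ u, g (inner ℝ x u) ∂uniformSphere = ∫ u, g (inner ℝ y u) ∂uniformSphere := by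
  obtain ⟨L, rfl⟩ := exists_linearIsometryEquiv_map_eq h
  rw [← (measurePreserving_uniformSphere L).integral_comp L.toHomeomorph.measurableEmbedding
    (fun u => g (inner ℝ (L x) u))]
  simp

lemma integral_coord : ∫ u : Space, u 0 ∂uniformSphere = 0 := by
  have := (measurePreserving_uniformSphere (LinearIsometryEquiv.neg ℝ)).integral_comp
    (LinearIsometryEquiv.neg ℝ (E := Space)).toHomeomorph.measurableEmbedding
    (fun u => u 0)
  simp only [LinearIsometryEquiv.coe_neg, PiLp.neg_apply, integral_neg] at this
  linarith

/-- By symmetry the three squared coordinates have equal means, and they sum to `1`. -/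
lemma integral_coord_sq : ∫ u : Space, u 0 ^ 2 ∂uniformSphere = 1 / 3 := by
  have h (i : Fin 3) : ∫ u : Space, u i ^ 2 ∂uniformSphere = ∫ u : Space, u 0 ^ 2 ∂uniformSphere := by
    have := integral_comp_inner_eq (· ^ 2) (x := EuclideanSpace.single i 1) (y := e₀) (by simp)
    simpa [EuclideanSpace.inner_single_left] using this
  have hs : ∫ u : Space, ∑ i, u i ^ 2 ∂uniformSphere = 1 := by
    rw [integral_congr_ae (g := fun _ => (1 : ℝ))]
    · simp
    · filter_upwards [ae_norm_eq_one] with u hu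
      rw [← EuclideanSpace.real_norm_sq_eq, hu, one_pow]
  rw [integral_finsetSum _ fun i _ => integrable_uniformSphere (by fun_prop),
    Finset.sum_congr rfl fun i _ => h i] at hs
  simp at hs
  linarith

/-- The mean absolute value of the inner product with a uniformly random direction. -/
lemma integral_abs_inner (x : Space) :
    ∫ u, |inner ℝ x u| ∂uniformSphere = ‖x‖ * ∫ u : Space, |u 0| ∂uniformSphere := by
  rw [integral_comp_inner_eq (fun t => |t|) (y := ‖x‖ • e₀) (by simp [norm_smul]),
    ← integral_const_mul]
  refine integral_congr_ae (ae_of_all _ fun u => ?_)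
  simp [inner_smul_left, abs_mul, EuclideanSpace.inner_single_left]

lemma integral_rpow_mul_exp_neg_sq {q : ℝ} (hq : -1 < q) :
    ∫ x in Set.Ioi (0 : ℝ), x ^ q * Real.exp (-x ^ 2) = 1 / 2 * Real.Gamma ((q + 1) / 2) := by
  have := integral_rpow_mul_exp_neg_rpow (p := 2) two_pos hq
  simpa using this

lemma integral_abs_mul_exp_neg_sq : ∫ x : ℝ, |x| * Real.exp (-x ^ 2) = 1 := by
  have h := integral_comp_abs (f := fun x => x * Real.exp (-x ^ 2))
  have h1 := integral_rpow_mul_exp_neg_sq (q := 1) (by norm_num)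
  norm_num at h1
  simp only [sq_abs] at h
  rw [h, h1]
  norm_num

/-- Polar coordinates: the Jacobian `r ^ 2` raises the exponent to `3`, and the result is `3 *
(4π/3) * (1/2)`. -/
lemma integral_norm_mul_exp_neg_norm_sq :
    ∫ x : Space, ‖x‖ * Real.exp (-‖x‖ ^ 2) = 2 * Real.pi := by
  rw [integral_fun_norm_addHaar (volume : Measure Space) (fun r => r * Real.exp (-r ^ 2))]
  have h1 := integral_rpow_mul_exp_neg_sq (q := 3) (by norm_num)
  have h2 : Real.Gamma ((3 + 1) / 2) = 1 := by
    rw [show ((3 : ℝ) + 1) / 2 = 2 by norm_num, Real.Gamma_two]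
  rw [h2] at h1
  have h3 : ∫ r in Set.Ioi (0 : ℝ), r ^ (Module.finrank ℝ Space - 1) • (r * Real.exp (-r ^ 2)) =
      1 / 2 := by
    rw [← mul_one (1 / 2 : ℝ), ← h1]
    refine setIntegral_congr_fun measurableSet_Ioi fun r _ => ?_
    simp only [finrank_euclideanSpace, Fintype.card_fin, smul_eq_mul]
    rw [show (3 : ℝ) = ((3 : ℕ) : ℝ) by norm_num, Real.rpow_natCast]
    ring
  rw [h3, Measure.real, EuclideanSpace.volume_ball_fin_three]
  rw [ENNReal.toReal_mul, ENNReal.toReal_ofReal (by positivity)]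
  simp
  ring

/-- A non-integrable function has integral `0` by convention, but the value just computed is
positive. -/
lemma integrable_norm_mul_exp_neg_norm_sq :
    Integrable (fun x : Space => ‖x‖ * Real.exp (-‖x‖ ^ 2)) := by
  by_contra h
  have := integral_undef h
  rw [integral_norm_mul_exp_neg_norm_sq] at this
  exact absurd this (by positivity)

lemma integral_abs_coord_mul_exp_neg_norm_sq :
    ∫ x : Space, |x 0| * Real.exp (-‖x‖ ^ 2) = Real.pi := by
  have hg : ∫ x : ℝ, Real.exp (-x ^ 2) = √Real.pi := by simpa using integral_gaussian 1
  rw [← (EuclideanSpace.volume_preserving_symm_measurableEquiv_toLp (Fin 3)).symm.integral_comp'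
    (g := fun x : Space => |x 0| * Real.exp (-‖x‖ ^ 2))]
  have key := integral_fin_nat_prod_volume_eq_prod (𝕜 := ℝ) (E := fun _ : Fin 3 => ℝ)
    ![fun x => |x| * Real.exp (-x ^ 2), fun x => Real.exp (-x ^ 2), fun x => Real.exp (-x ^ 2)]
  simp only [Fin.prod_univ_three, Matrix.cons_val_zero, Matrix.cons_val_one, Matrix.cons_val,
    hg, integral_abs_mul_exp_neg_sq, one_mul, Real.mul_self_sqrt Real.pi_nonneg] at key
  rw [← key]
  refine integral_congr_ae (ae_of_all _ fun x => ?_)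
  simp only [EuclideanSpace.real_norm_sq_eq, Fin.sum_univ_three, neg_add, Real.exp_add]
  simp [mul_assoc]

lemma integral_abs_inner_mul_exp_neg_norm_sq {u : Space} (hu : ‖u‖ = 1) :
    ∫ x : Space, |inner ℝ x u| * Real.exp (-‖x‖ ^ 2) = Real.pi := by
  obtain ⟨L, hL⟩ := exists_linearIsometryEquiv_map_eq (x := u) (y := e₀) (by simp [hu])
  rw [← integral_abs_coord_mul_exp_neg_norm_sq,
    ← L.measurePreserving.integral_comp L.toHomeomorph.measurableEmbedding
      (fun x : Space => |x 0| * Real.exp (-‖x‖ ^ 2))]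
  simp only [← inner_e₀, ← hL, LinearIsometryEquiv.inner_map_map, LinearIsometryEquiv.norm_map]

/-- A coordinate of a uniformly random direction in `ℝ³` has mean absolute value `1 / 2`. -/
lemma integral_abs_coord : ∫ u : Space, |u 0| ∂uniformSphere = 1 / 2 := by
  -- The constant comes from computing one Gaussian-weighted double integral in both orders:
  -- integrating over `u` first gives `2π` times the unknown mean, over `x` first gives `π`.
  have hint : Integrable (Function.uncurry fun x u : Space => |inner ℝ x u| * Real.exp (-‖x‖ ^ 2))
      (volume.prod uniformSphere) := by
    refine (integrable_norm_mul_exp_neg_norm_sq.comp_fst uniformSphere).mono' ?_ ?_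
    · exact Continuous.aestronglyMeasurable (by unfold Function.uncurry; fun_prop)
    · have h := (Measure.quasiMeasurePreserving_snd (μ := (volume : Measure Space))
        (ν := uniformSphere)).ae ae_norm_eq_one
      filter_upwards [h] with p hp
      simp only [Function.uncurry, norm_mul, Real.norm_eq_abs, abs_abs, Real.abs_exp]
      gcongr
      simpa [hp] using abs_real_inner_le_norm p.1 p.2
  have hswap := integral_integral_swap hint
  have hl (x : Space) : ∫ u, |inner ℝ x u| * Real.exp (-‖x‖ ^ 2) ∂uniformSphere =
      (∫ u : Space, |u 0| ∂uniformSphere) * (‖x‖ * Real.exp (-‖x‖ ^ 2)) := by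
    rw [integral_mul_const, integral_abs_inner]
    ring
  have hr : ∫ u, (∫ x : Space, |inner ℝ x u| * Real.exp (-‖x‖ ^ 2)) ∂uniformSphere = Real.pi := by
    rw [integral_congr_ae (g := fun _ => Real.pi)]
    · simp
    · filter_upwards [ae_norm_eq_one] with u hu
      exact integral_abs_inner_mul_exp_neg_norm_sq hu
  rw [hr] at hswap
  simp only [hl] at hswap
  rw [integral_const_mul, integral_norm_mul_exp_neg_norm_sq] at hswap
  have := Real.pi_pos
  field_simp
  nlinarith

/-! ### Reduction of the mean distance to one coordinate -/

lemma norm_sum_le_of_norm_eq_one {n : ℕ} {v : Fin n → Space} (hv : ∀ i, ‖v i‖ = 1) :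
    ‖∑ i, v i‖ ≤ n :=
  (norm_sum_le _ _).trans (by simp [hv])

/-- Rotating all steps at once preserves their joint law, so `u` may be moved to `e₀`. -/
lemma integral_abs_inner_sum {n : ℕ} {u : Space} (hu : ‖u‖ = 1) :
    ∫ v, |inner ℝ (∑ i, v i) u| ∂uniformDirections n =
      ∫ v, |∑ i, v i 0| ∂uniformDirections n := by
  obtain ⟨L, hL⟩ := exists_linearIsometryEquiv_map_eq (x := u) (y := e₀) (by simp [hu])
  have h := (measurePreserving_uniformDirections fun _ : Fin n => L).integral_comp
    (MeasurableEquiv.piCongrRight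
      fun _ : Fin n => L.toHomeomorph.toMeasurableEquiv).measurableEmbedding
    (fun v => |inner ℝ (∑ i, v i) e₀|)
  simp only [← map_sum, ← hL, LinearIsometryEquiv.inner_map_map] at h
  rw [h, hL]
  simp only [inner_e₀, WithLp.ofLp_sum, Finset.sum_apply]

/-- The mean distance of the random walk is twice the mean distance of its first coordinate. -/
lemma meanDistance_eq_two_mul (n : ℕ) :
    meanDistance n = 2 * ∫ v, |∑ i, v i 0| ∂uniformDirections n := by
  -- An auxiliary uniform `u`, independent of the walk, is averaged in both orders: over `u` it
  -- gives half the norm of the sum, over `v` a value that is the same for every unit `u`.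
  have hint : Integrable (Function.uncurry fun (v : Fin n → Space) (u : Space) =>
      |inner ℝ (∑ i, v i) u|) ((uniformDirections n).prod uniformSphere) := by
    refine Integrable.of_bound
      (Continuous.aestronglyMeasurable (by unfold Function.uncurry; fun_prop)) n ?_
    have h := (Measure.quasiMeasurePreserving_snd (μ := uniformDirections n)
        (ν := uniformSphere)).ae ae_norm_eq_one
    have h' := (Measure.quasiMeasurePreserving_fst (μ := uniformDirections n)
        (ν := uniformSphere)).ae (ae_norm_directions_eq_one n)
    filter_upwards [h, h'] with p hp hp'
    simp only [Function.uncurry, Real.norm_eq_abs, abs_abs]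
    refine (abs_real_inner_le_norm _ _).trans ?_
    rw [hp, mul_one]
    exact norm_sum_le_of_norm_eq_one hp'
  have hswap := integral_integral_swap hint
  have hr : ∫ u, ∫ v, |inner ℝ (∑ i, v i) u| ∂uniformDirections n ∂uniformSphere =
      ∫ v, |∑ i, v i 0| ∂uniformDirections n := by
    rw [integral_congr_ae (g := fun _ => ∫ v, |∑ i, v i 0| ∂uniformDirections n)]
    · simp
    · filter_upwards [ae_norm_eq_one] with u hu
      exact integral_abs_inner_sum hu
  rw [hr] at hswap
  simp only [integral_abs_inner, integral_abs_coord] at hswap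
  rw [integral_mul_const] at hswap
  rw [← hswap, meanDistance]
  ring

/-! ### The central limit theorem and the growth of the mean distance -/

section RandomWalk

open ProbabilityTheory Topology

lemma integrable_abs_of_sq {μ : Measure ℝ} [IsFiniteMeasure μ]
    (h : Integrable (fun x : ℝ => x ^ 2) μ) : Integrable (fun x : ℝ => |x|) μ := by
  have h2 : MemLp (fun x : ℝ => x) 2 μ := (memLp_two_iff_integrable_sq (by fun_prop)).2 h
  exact (h2.integrable one_le_two).abs

/-- The truncation error vanishes for `|x| ≤ M` and is at most `|x| ≤ x ^ 2 / M` beyond. -/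
lemma abs_sub_min_integral_le {μ : Measure ℝ} [IsProbabilityMeasure μ]
    (h : Integrable (fun x : ℝ => x ^ 2) μ) {M : ℝ} (hM : 0 < M) :
    |∫ x, |x| ∂μ - ∫ x, min |x| M ∂μ| ≤ (∫ x, x ^ 2 ∂μ) / M := by
  have ha := integrable_abs_of_sq h
  have hm : Integrable (fun x : ℝ => min |x| M) μ := by
    refine ha.mono' (by fun_prop) (ae_of_all _ fun x => ?_)
    rw [Real.norm_eq_abs, abs_of_nonneg (le_min (abs_nonneg x) hM.le)]
    exact min_le_left _ _
  rw [← integral_sub ha hm, ← integral_div]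
  refine (abs_integral_le_integral_abs).trans
    (integral_mono (ha.sub hm).abs (h.div_const M) fun x => ?_)
  simp only
  rw [le_div_iff₀ hM]
  rcases le_total |x| M with hx | hx
  · rw [min_eq_left hx, sub_self, abs_zero, zero_mul]
    positivity
  · rw [min_eq_right hx, abs_of_nonneg (by linarith), ← sq_abs]
    nlinarith [abs_nonneg x]

/-- Weak convergence together with bounded second moments gives convergence of the first absolute
moments. -/
lemma tendsto_integral_abs {μs : ℕ → ProbabilityMeasure ℝ} {μ : ProbabilityMeasure ℝ}
    (h : Tendsto μs atTop (𝓝 μ)) {C : ℝ}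
    (hs : ∀ n, Integrable (fun x : ℝ => x ^ 2) (μs n : Measure ℝ))
    (hsC : ∀ n, ∫ x, x ^ 2 ∂(μs n : Measure ℝ) ≤ C)
    (hμ : Integrable (fun x : ℝ => x ^ 2) (μ : Measure ℝ))
    (hμC : ∫ x, x ^ 2 ∂(μ : Measure ℝ) ≤ C) :
    Tendsto (fun n => ∫ x, |x| ∂(μs n : Measure ℝ)) atTop (𝓝 (∫ x, |x| ∂(μ : Measure ℝ))) := by
  have hC : 0 ≤ C := (integral_nonneg fun x => sq_nonneg x).trans hμC
  rw [Metric.tendsto_atTop]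
  intro ε hε
  -- This makes each of the two truncation errors less than `ε / 3`; the `+ 1` keeps `M` positive
  -- when `C = 0`.
  set M : ℝ := 3 * (C + 1) / ε with hMdef
  have hM : 0 < M := by positivity
  have hCM : C / M < ε / 3 := by
    rw [div_lt_iff₀ hM, hMdef]
    field_simp
    linarith
  have hmin := ProbabilityMeasure.tendsto_iff_forall_integral_tendsto.1 h
    (BoundedContinuousFunction.ofNormedAddCommGroup (fun x : ℝ => min |x| M) (by fun_prop) M
      fun x => by
        rw [Real.norm_eq_abs, abs_of_nonneg (le_min (abs_nonneg x) hM.le)]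
        exact min_le_right _ _)
  obtain ⟨N, hN⟩ := Metric.tendsto_atTop.1 hmin (ε / 3) (by positivity)
  refine ⟨N, fun n hn => ?_⟩
  have h1 := (abs_sub_min_integral_le (hs n) hM).trans (div_le_div_of_nonneg_right (hsC n) hM.le)
  have h2 := (abs_sub_min_integral_le hμ hM).trans (div_le_div_of_nonneg_right hμC hM.le)
  have h3 := hN n hn
  simp only [BoundedContinuousFunction.coe_ofNormedAddCommGroup, Real.dist_eq, abs_lt] at h3 ⊢
  rw [abs_le] at h1 h2
  constructor <;> linarith [h1.1, h1.2, h2.1, h2.2, h3.1, h3.2]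

lemma integral_abs_gaussianReal : ∫ x, |x| ∂gaussianReal 0 1 = √(2 / Real.pi) := by
  rw [integral_gaussianReal_eq_integral_smul one_ne_zero]
  have h := integral_comp_abs (f := fun x => (√(2 * Real.pi))⁻¹ * (x * Real.exp (-(1 / 2) * x ^ 2)))
  have h1 := integral_rpow_mul_exp_neg_mul_rpow (p := 2) (q := 1) (b := 1 / 2) two_pos
    (by norm_num) (by norm_num)
  norm_num [Real.rpow_neg_one] at h1
  simp only [sq_abs, integral_const_mul] at h
  norm_num at h
  rw [h1] at h
  have e : ∫ x : ℝ, gaussianPDFReal 0 1 x • |x| =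
      (√Real.pi)⁻¹ * (√2)⁻¹ * ∫ x : ℝ, |x| * Real.exp (-(1 / 2 * x ^ 2)) := by
    rw [← integral_const_mul]
    refine integral_congr_ae (ae_of_all _ fun x => ?_)
    simp [gaussianPDFReal]
    ring_nf
  rw [e, h, Real.sqrt_div two_pos.le]
  have := Real.sqrt_pos.2 Real.pi_pos
  have h2 : √2 * √2 = (2 : ℝ) := Real.mul_self_sqrt two_pos.le
  field_simp
  nlinarith

/-- The first coordinates of the steps of the infinite random walk, scaled to unit variance. -/
def scaledCoord (k : ℕ) (ω : ℕ → Space) : ℝ := √3 * ω k 0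

/-- The law of the steps of the infinite random walk. -/
abbrev walkMeasure : Measure (ℕ → Space) := Measure.infinitePi fun _ => uniformSphere

lemma measurable_scaledCoord (k : ℕ) : Measurable (scaledCoord k) := by
  unfold scaledCoord; fun_prop

lemma iIndepFun_scaledCoord : iIndepFun scaledCoord walkMeasure :=
  iIndepFun_infinitePi (X := fun _ (v : Space) => √3 * v 0) fun _ => by fun_prop

lemma identDistrib_scaledCoord (k : ℕ) :
    IdentDistrib (scaledCoord k) (fun u : Space => √3 * u 0) walkMeasure uniformSphere where
  aemeasurable_fst := (measurable_scaledCoord k).aemeasurable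
  aemeasurable_snd := by fun_prop
  map_eq := by
    rw [← (measurePreserving_eval_infinitePi (fun _ : ℕ => uniformSphere) k).map_eq,
      Measure.map_map (by fun_prop) (by fun_prop)]
    rfl

lemma memLp_scaledCoord (k : ℕ) : MemLp (scaledCoord k) 2 walkMeasure := by
  rw [(identDistrib_scaledCoord k).memLp_iff, memLp_two_iff_integrable_sq (by fun_prop)]
  exact integrable_uniformSphere (by fun_prop)

lemma integral_scaledCoord (k : ℕ) : ∫ ω, scaledCoord k ω ∂walkMeasure = 0 := by
  rw [(identDistrib_scaledCoord k).integral_eq, integral_const_mul, integral_coord, mul_zero]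

lemma integral_scaledCoord_sq (k : ℕ) : ∫ ω, scaledCoord k ω ^ 2 ∂walkMeasure = 1 := by
  rw [(identDistrib_scaledCoord k).sq.integral_eq]
  simp [mul_pow, integral_const_mul, integral_coord_sq]

/-- Variances of independent centred variables add. This supplies the uniform second-moment bound
for the limit theorem. -/
lemma integral_sum_scaledCoord_sq (n : ℕ) :
    ∫ ω, (∑ k ∈ Finset.range n, scaledCoord k ω) ^ 2 ∂walkMeasure = n := by
  have hv := IndepFun.variance_sum (X := scaledCoord) (s := Finset.range n) (μ := walkMeasure)
    (fun k _ => memLp_scaledCoord k) (fun i _ j _ hij => iIndepFun_scaledCoord.indepFun hij)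
  have hv1 (k : ℕ) : Var[scaledCoord k; walkMeasure] = 1 := by
    rw [variance_of_integral_eq_zero (measurable_scaledCoord k).aemeasurable
      (integral_scaledCoord k), integral_scaledCoord_sq]
  rw [variance_of_integral_eq_zero] at hv
  · simpa [hv1] using hv
  · exact Finset.aemeasurable_sum _ fun k _ => (measurable_scaledCoord k).aemeasurable
  · simp only [Finset.sum_apply]
    rw [integral_finsetSum _ fun k _ => (memLp_scaledCoord k).integrable one_le_two]
    simp [integral_scaledCoord]

lemma integral_abs_sum_scaledCoord (n : ℕ) :
    ∫ ω, |∑ k ∈ Finset.range n, scaledCoord k ω| ∂walkMeasure = √3 * (meanDistance n / 2) := by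
  have hmap : walkMeasure.map (fun ω (i : Fin n) => ω i) = uniformDirections n := by
    rw [walkMeasure, Measure.map_infinitePi_infinitePi_of_inj Fin.val_injective,
      Measure.infinitePi_eq_pi, uniformDirections]
  rw [meanDistance_eq_two_mul, ← hmap, mul_div_cancel_left₀ _ two_ne_zero,
    integral_map (measurable_pi_lambda _ fun i => measurable_pi_apply _).aemeasurable
      (Continuous.aestronglyMeasurable (by fun_prop)), ← integral_const_mul]
  refine integral_congr_ae (ae_of_all _ fun ω => ?_)
  simp only [scaledCoord, ← Finset.mul_sum, abs_mul, abs_of_nonneg (Real.sqrt_nonneg 3),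
    Finset.sum_range]

/-- The mean distance of the random walk grows like the square root of the number of steps. -/
lemma tendsto_meanDistance_div_sqrt :
    Tendsto (fun n : ℕ => (√n)⁻¹ * meanDistance n) atTop (𝓝 (2 * √(2 / (3 * Real.pi)))) := by
  have hclt := tendstoInDistribution_inv_sqrt_mul_sum (P := walkMeasure) (X := scaledCoord)
    (P' := gaussianReal 0 1) (Y := id) ⟨by fun_prop, by simp⟩ (integral_scaledCoord 0)
    (integral_scaledCoord_sq 0) iIndepFun_scaledCoord
    (fun i => (identDistrib_scaledCoord i).trans (identDistrib_scaledCoord 0).symm)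
  have hmeas (n : ℕ) : Measurable fun ω : ℕ → Space =>
      (√n)⁻¹ * ∑ k ∈ Finset.range n, scaledCoord k ω :=
    (Finset.measurable_fun_sum _ fun k _ => measurable_scaledCoord k).const_mul _
  have hsum (n : ℕ) : MemLp (fun ω : ℕ → Space => (√n)⁻¹ * ∑ k ∈ Finset.range n, scaledCoord k ω)
      2 walkMeasure :=
    (memLp_finsetSum _ fun k _ => memLp_scaledCoord k).const_mul _
  have hlim := tendsto_integral_abs (C := 1) hclt.tendsto ?_ ?_ ?_ ?_
  · simp only [ProbabilityMeasure.coe_mk, Measure.map_id, integral_abs_gaussianReal] at hlim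
    -- The factor `2 / √3` undoes the scaling to unit variance and the halving in
    -- `meanDistance_eq_two_mul`.
    have hlim' := hlim.const_mul (2 / √3)
    have e : 2 / √3 * √(2 / Real.pi) = 2 * √(2 / (3 * Real.pi)) := by
      rw [Real.sqrt_div two_pos.le, Real.sqrt_div two_pos.le, Real.sqrt_mul (by norm_num)]
      field_simp
    rw [e] at hlim'
    refine hlim'.congr fun n => ?_
    rw [integral_map (hmeas n).aemeasurable (by fun_prop)]
    simp only [abs_mul, abs_inv, abs_of_nonneg (Real.sqrt_nonneg _), integral_const_mul,
      integral_abs_sum_scaledCoord]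
    field_simp
  · intro n
    simp only [ProbabilityMeasure.coe_mk]
    rw [integrable_map_measure (by fun_prop) (hmeas n).aemeasurable]
    exact (hsum n).integrable_sq
  · intro n
    simp only [ProbabilityMeasure.coe_mk]
    rw [integral_map (hmeas n).aemeasurable (by fun_prop)]
    simp only [mul_pow, integral_const_mul, integral_sum_scaledCoord_sq]
    rw [inv_pow, Real.sq_sqrt n.cast_nonneg]
    -- Only an inequality, since the product is `0` at `n = 0`.
    exact inv_mul_le_one
  · simpa using (memLp_id_gaussianReal' (μ := 0) (v := 1) 2 (by simp)).integrable_sq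
  · have := variance_of_integral_eq_zero (μ := gaussianReal 0 1) (X := id) aemeasurable_id
      (by simp)
    simp at this
    simp [← this]

end RandomWalk

/-! ### Qubits and the Bloch sphere -/

/-- A polynomial identity in real and imaginary parts. Allowing unnormalized vectors lets `a = b`
yield the norm of the Bloch vector. -/
lemma norm_inner_sq (a b : Qubit) :
    ‖inner ℂ a b‖ ^ 2 = 1 / 2 * (‖a‖ ^ 2 * ‖b‖ ^ 2 + inner ℝ (bloch a) (bloch b)) := by
  simp only [EuclideanSpace.norm_sq_eq, PiLp.inner_apply, Fin.sum_univ_two, Fin.sum_univ_three,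
    RCLike.inner_apply, bloch, Complex.sq_norm, Complex.normSq_apply, Complex.add_re,
    Complex.add_im, Complex.mul_re, Complex.mul_im, Complex.conj_re, Complex.conj_im]
  simp
  ring

lemma norm_bloch (a : Qubit) : ‖bloch a‖ = ‖a‖ ^ 2 := by
  have h := norm_inner_sq a a
  rw [inner_self_eq_norm_sq_to_K, real_inner_self_eq_norm_sq] at h
  simp only [norm_pow, RCLike.norm_ofReal, abs_norm] at h
  refine (sq_eq_sq₀ (norm_nonneg _) (by positivity)).1 ?_
  linarith

/-- A pure state orthogonal to `ψ`, of the same norm. -/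
def antipode (ψ : Qubit) : Qubit := !₂[-starRingEnd ℂ (ψ 1), starRingEnd ℂ (ψ 0)]

lemma norm_antipode (ψ : Qubit) : ‖antipode ψ‖ = ‖ψ‖ := by
  simp [EuclideanSpace.norm_eq, antipode, add_comm]

lemma inner_antipode (ψ : Qubit) : inner ℂ ψ (antipode ψ) = 0 := by
  simp [antipode, PiLp.inner_apply, Fin.sum_univ_two]
  ring

lemma bloch_antipode (ψ : Qubit) : bloch (antipode ψ) = -bloch ψ := by
  ext i
  fin_cases i <;> simp [bloch, antipode] <;> ring

/-- A pure state with a given unit vector as its Bloch vector. -/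
def blochState (r : Space) : Qubit :=
  if r 2 = -1 then !₂[0, 1]
  else !₂[(√((1 + r 2) / 2) : ℂ), ⟨r 0 / (2 * √((1 + r 2) / 2)), r 1 / (2 * √((1 + r 2) / 2))⟩]

lemma bloch_blochState {r : Space} (hr : ‖r‖ = 1) : bloch (blochState r) = r := by
  have h : r 0 ^ 2 + r 1 ^ 2 + r 2 ^ 2 = 1 := by
    rw [← Fin.sum_univ_three (fun i => r i ^ 2), ← EuclideanSpace.real_norm_sq_eq, hr, one_pow]
  unfold blochState
  -- At the south pole the first amplitude `√((1 + r 2) / 2)` vanishes and cannot be divided by;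
  -- elsewhere it is positive.
  split_ifs with h2
  · rw [h2] at h
    have h0 : r 0 = 0 := by nlinarith [sq_nonneg (r 0), sq_nonneg (r 1)]
    have h1 : r 1 = 0 := by nlinarith [sq_nonneg (r 0), sq_nonneg (r 1)]
    ext i
    fin_cases i <;> simp [bloch, h0, h1, h2]
  · have hlt : -1 < r 2 := lt_of_le_of_ne (by nlinarith [sq_nonneg (r 0), sq_nonneg (r 1)])
      (Ne.symm h2)
    set c := √((1 + r 2) / 2) with hc
    have hc0 : 0 < c := Real.sqrt_pos.2 (by linarith)
    have hc2 : c ^ 2 = (1 + r 2) / 2 := Real.sq_sqrt (by linarith)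
    ext i
    fin_cases i
    · simp [bloch]
      field_simp
    · simp [bloch]
      field_simp
    · have e : r 2 = 2 * c ^ 2 - 1 := by linarith
      have e' : r 0 ^ 2 + r 1 ^ 2 = (2 * c) ^ 2 * (1 - c ^ 2) := by
        rw [e] at h; linear_combination h
      have e2 : r 0 / (2 * c) * (r 0 / (2 * c)) + r 1 / (2 * c) * (r 1 / (2 * c)) = 1 - c ^ 2 := by
        field_simp
        linarith
      simp only [bloch, Complex.sq_norm]
      simp [Complex.normSq_mk, Complex.normSq_ofReal]
      rw [e2, e]
      ring

lemma norm_blochState {r : Space} (hr : ‖r‖ = 1) : ‖blochState r‖ = 1 := by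
  have h := norm_bloch (blochState r)
  rw [bloch_blochState hr, hr] at h
  exact (sq_eq_sq₀ (norm_nonneg _) zero_le_one).1 (by rw [← h, one_pow])

/-- Normalization of vectors, with an arbitrary value at the origin. -/
def unitVec (r : Space) : Space := if r = 0 then e₀ else ‖r‖⁻¹ • r

lemma norm_unitVec (r : Space) : ‖unitVec r‖ = 1 := by
  unfold unitVec
  split_ifs with h
  · simp
  · rw [norm_smul, norm_inv, norm_norm, inv_mul_cancel₀ (norm_ne_zero_iff.2 h)]

/-- Holds at the origin too, where both sides are `0`, so the encoding is optimal even when the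
directions cancel. -/
lemma inner_unitVec_self (r : Space) : inner ℝ r (unitVec r) = ‖r‖ := by
  unfold unitVec
  split_ifs with h
  · simp [h]
  · rw [inner_smul_right, real_inner_self_eq_norm_sq, sq,
      inv_mul_cancel_left₀ (norm_ne_zero_iff.2 h)]

lemma unitVec_of_norm_eq_one {r : Space} (hr : ‖r‖ = 1) : unitVec r = r := by
  have h : r ≠ 0 := fun h => by simp [h] at hr
  simp [unitVec, h, hr]

@[fun_prop]
lemma measurable_unitVec : Measurable unitVec :=
  Measurable.ite (measurableSet_singleton 0) measurable_const (by fun_prop)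

@[fun_prop]
lemma measurable_blochState : Measurable blochState := by
  unfold blochState
  refine Measurable.ite (measurableSet_eq_fun (by fun_prop) (by fun_prop)) measurable_const ?_
  refine (PiLp.continuous_toLp 2 _).measurable.comp (measurable_pi_lambda _ fun i => ?_)
  have hm : Measurable fun r : Space => (⟨r 0 / (2 * √((1 + r 2) / 2)),
      r 1 / (2 * √((1 + r 2) / 2))⟩ : ℂ) := by
    simp only [Complex.mk_eq_add_mul_I]
    fun_prop
  fin_cases i
  · simp only [Fin.zero_eta, Matrix.cons_val_zero]; fun_prop
  · simp only [Fin.mk_one, Matrix.cons_val_one]; fun_prop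

@[fun_prop]
lemma measurable_antipode : Measurable antipode :=
  Continuous.measurable (by unfold antipode; fun_prop)

@[fun_prop]
lemma measurable_bloch : Measurable bloch :=
  Continuous.measurable (by unfold bloch; fun_prop)

/-! ### Optimal encodings and the random strategy -/

variable {n : ℕ}

/-- The sum of the Bloch vectors of the states that decode to the bits of `x`. -/
def PureStrategy.blochSum (s : PureStrategy n) (x : Fin n → Bool) : Space :=
  ∑ i, bloch (s.meas i (x i))

lemma PureStrategy.successProb_eq (s : PureStrategy n) (x : Fin n → Bool) (i : Fin n) :
    s.successProb x i = 1 / 2 * (1 + inner ℝ (bloch (s.meas i (x i))) (bloch (s.enc x))) := by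
  rw [successProb, norm_inner_sq, s.norm_enc, (s.orthonormal_meas i).1]
  norm_num

lemma PureStrategy.sum_successProb (s : PureStrategy n) (x : Fin n → Bool) :
    ∑ i, s.successProb x i = 1 / 2 * (n + inner ℝ (s.blochSum x) (bloch (s.enc x))) := by
  simp only [s.successProb_eq, ← Finset.mul_sum, Finset.sum_add_distrib, blochSum, sum_inner]
  simp

/-- The strings can be optimized separately: encodings are unit Bloch vectors, so Cauchy–Schwarz
bounds each inner product by the norm attained here. -/
lemma PureStrategy.hasOptimalEncoding_of_inner (s : PureStrategy n)
    (h : ∀ x, inner ℝ (s.blochSum x) (bloch (s.enc x)) = ‖s.blochSum x‖) :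
    s.HasOptimalEncoding := by
  intro t ht
  unfold averageSuccess
  refine mul_le_mul_of_nonneg_left (Finset.sum_le_sum fun x _ => ?_) (by positivity)
  rw [sum_successProb, sum_successProb, h]
  have e : t.blochSum x = s.blochSum x := by simp [blochSum, ht]
  have := real_inner_le_norm (t.blochSum x) (bloch (t.enc x))
  rw [norm_bloch, t.norm_enc, e] at this
  rw [e]
  linarith

/-- The sign `(-1) ^ b` of a bit. -/
def bitSign (b : Bool) : ℝ := if b then -1 else 1

/-- The strategy that measures in given directions and encodes optimally for them. -/
def directionStrategy (v : Fin n → Space) : PureStrategy n where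
  enc x := blochState (unitVec (∑ i, bitSign (x i) • unitVec (v i)))
  meas i b := if b then antipode (blochState (unitVec (v i))) else blochState (unitVec (v i))
  norm_enc _ := norm_blochState (norm_unitVec _)
  orthonormal_meas i := by
    have h := norm_blochState (norm_unitVec (v i))
    refine ⟨fun b => ?_, fun b c hbc => ?_⟩
    · cases b <;> simp [norm_antipode, h]
    · cases b <;> cases c <;>
        simp_all [inner_antipode, inner_eq_zero_symm.1 (inner_antipode _)]

lemma bloch_meas_directionStrategy (v : Fin n → Space) (i : Fin n) (b : Bool) :
    bloch ((directionStrategy v).meas i b) = bitSign b • unitVec (v i) := by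
  cases b <;> simp [directionStrategy, bitSign, bloch_antipode, bloch_blochState, norm_unitVec]

lemma bloch_enc_directionStrategy (v : Fin n → Space) (x : Fin n → Bool) :
    bloch ((directionStrategy v).enc x) = unitVec (∑ i, bitSign (x i) • unitVec (v i)) :=
  bloch_blochState (norm_unitVec _)

lemma inner_blochSum_directionStrategy (v : Fin n → Space) (x : Fin n → Bool) :
    inner ℝ ((directionStrategy v).blochSum x) (bloch ((directionStrategy v).enc x)) =
      ‖(directionStrategy v).blochSum x‖ := by
  simp only [PureStrategy.blochSum, bloch_meas_directionStrategy, bloch_enc_directionStrategy,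
    inner_unitVec_self]

lemma PureStrategy.measurable_enc (x : Fin n → Bool) :
    Measurable fun s : PureStrategy n => s.enc x :=
  (measurable_pi_apply x).comp (measurable_fst.comp (comap_measurable _))

lemma PureStrategy.measurable_meas (i : Fin n) (b : Bool) :
    Measurable fun s : PureStrategy n => s.meas i b :=
  (measurable_pi_apply b).comp
    ((measurable_pi_apply i).comp (measurable_snd.comp (comap_measurable _)))

lemma PureStrategy.measurable_direction :
    Measurable (PureStrategy.direction : PureStrategy n → Fin n → Space) :=
  measurable_pi_lambda _ fun i => measurable_bloch.comp (measurable_meas i false)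

lemma PureStrategy.measurable_blochSum (x : Fin n → Bool) :
    Measurable fun s : PureStrategy n => s.blochSum x :=
  Finset.measurable_fun_sum _ fun i _ => measurable_bloch.comp (measurable_meas i (x i))

lemma PureStrategy.measurable_successProb (x : Fin n → Bool) (i : Fin n) :
    Measurable fun s : PureStrategy n => s.successProb x i :=
  ((measurable_meas i (x i)).inner (measurable_enc x)).norm.pow_const 2

lemma measurable_directionStrategy :
    Measurable (directionStrategy : (Fin n → Space) → PureStrategy n) := by
  refine measurable_comap_iff.2 (Measurable.prodMk ?_ ?_)
  · refine measurable_pi_lambda _ fun x => ?_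
    simp only [directionStrategy]
    fun_prop
  · refine measurable_pi_lambda _ fun i => measurable_pi_lambda _ fun b => ?_
    cases b <;> simp only [directionStrategy] <;> simp <;> fun_prop

/-- The strategy that measures in independent uniformly random directions and encodes optimally. -/
def randomStrategy (n : ℕ) : SharedStrategy n :=
  ⟨(uniformDirections n).map directionStrategy,
    Measure.isProbabilityMeasure_map measurable_directionStrategy.aemeasurable⟩

lemma coe_randomStrategy (n : ℕ) : (randomStrategy n : Measure (PureStrategy n)) =
    (uniformDirections n).map directionStrategy := rfl

lemma isRandomMeasurement_randomStrategy (n : ℕ) : (randomStrategy n).IsRandomMeasurement where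
  map_direction := by
    rw [coe_randomStrategy, Measure.map_map PureStrategy.measurable_direction
      measurable_directionStrategy]
    conv_rhs => rw [← Measure.map_id (μ := uniformDirections n)]
    -- The strategy normalizes its directions to be defined for all `v`; this changes nothing almost
    -- everywhere.
    refine Measure.map_congr ?_
    filter_upwards [ae_norm_directions_eq_one n] with v hv
    ext1 i
    rw [Function.comp_apply, PureStrategy.direction, bloch_meas_directionStrategy,
      unitVec_of_norm_eq_one (hv i)]
    simp [bitSign]
  optimal := by
    -- Optimality quantifies over all strategies, so an evidently measurable sufficient condition is
    -- transferred through the pushforward instead.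
    have hm : MeasurableSet {s : PureStrategy n | ∀ x,
        inner ℝ (s.blochSum x) (bloch (s.enc x)) = ‖s.blochSum x‖} := by
      simp only [Set.ofPred_forall]
      refine MeasurableSet.iInter fun x => ?_
      have h := PureStrategy.measurable_blochSum x
      exact measurableSet_eq_fun
        (h.inner (measurable_bloch.comp (PureStrategy.measurable_enc x))) h.norm
    have h : ∀ᵐ s ∂(randomStrategy n : Measure (PureStrategy n)), ∀ x,
        inner ℝ (s.blochSum x) (bloch (s.enc x)) = ‖s.blochSum x‖ := by
      rw [coe_randomStrategy, ae_map_iff measurable_directionStrategy.aemeasurable hm]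
      exact ae_of_all _ inner_blochSum_directionStrategy
    exact h.mono fun s hs => s.hasOptimalEncoding_of_inner hs

/-! ### Success probabilities and asymptotics -/

/-- The mean of the component of a step along the direction of the random walk. -/
def meanComponent (n : ℕ) (i : Fin n) : ℝ :=
  ∫ v, inner ℝ (v i) (unitVec (∑ j, v j)) ∂uniformDirections n

lemma integrable_component (i : Fin n) :
    Integrable (fun v => inner ℝ (v i) (unitVec (∑ j, v j))) (uniformDirections n) := by
  refine Integrable.of_bound (Measurable.aestronglyMeasurable (by fun_prop)) 1 ?_
  filter_upwards [ae_norm_directions_eq_one n] with v hv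
  refine (norm_inner_le_norm _ _).trans ?_
  rw [hv, norm_unitVec, one_mul]

/-- The steps are exchangeable, so all components have the same mean; their sum is the length of the
walk. -/
lemma meanComponent_eq (i : Fin n) : meanComponent n i = 1 / n * meanDistance n := by
  have h (j : Fin n) : meanComponent n j = meanComponent n i := by
    have hp := measurePreserving_uniformDirections_perm (Equiv.swap i j)
    rw [meanComponent, meanComponent]
    conv_rhs =>
      rw [← hp.map_eq, integral_map hp.aemeasurable (Measurable.aestronglyMeasurable (by fun_prop))]
    simp only [Equiv.swap_apply_left]
    refine integral_congr_ae (ae_of_all _ fun v => ?_)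
    simp only [Equiv.sum_comp (Equiv.swap i j) v]
  have hs : ∑ j, meanComponent n j = meanDistance n := by
    simp only [meanComponent]
    rw [← integral_finsetSum _ fun j _ => integrable_component j]
    simp only [← sum_inner, inner_unitVec_self, meanDistance]
  rw [Finset.sum_congr rfl fun j _ => h j] at hs
  simp only [Finset.sum_const, Finset.card_univ, Fintype.card_fin, nsmul_eq_mul] at hs
  have : (n : ℝ) ≠ 0 := by exact_mod_cast (Fin.pos i).ne'
  rw [← hs]
  field_simp

/-- Flipping each `v j` by the sign of `x j` preserves the law of the directions and turns the
integrand into the one for the all-zero string, so `x` drops out. -/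
lemma successProb_randomStrategy (x : Fin n → Bool) (i : Fin n) :
    (randomStrategy n).successProb x i = 1 / 2 * (1 + 1 / n * meanDistance n) := by
  rw [SharedStrategy.successProb, coe_randomStrategy,
    integral_map measurable_directionStrategy.aemeasurable
      (PureStrategy.measurable_successProb x i).aestronglyMeasurable]
  let L : Fin n → Space ≃ₗᵢ[ℝ] Space := fun j =>
    if x j then LinearIsometryEquiv.neg ℝ else LinearIsometryEquiv.refl ℝ Space
  have hL (j : Fin n) (y : Space) : L j y = bitSign (x j) • y := by
    simp only [L, bitSign]; split_ifs <;> simp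
  have hi := (measurePreserving_uniformDirections L).integral_comp
    (MeasurableEquiv.piCongrRight
      fun j : Fin n => (L j).toHomeomorph.toMeasurableEquiv).measurableEmbedding
    (fun v => 1 / 2 * (1 + inner ℝ (v i) (unitVec (∑ j, v j))))
  rw [← meanComponent_eq i, meanComponent]
  conv_rhs at hi =>
    rw [integral_const_mul, integral_add (integrable_const _) (integrable_component i)]
  simp only [integral_const (1 : ℝ), probReal_univ, smul_eq_mul, mul_one] at hi
  rw [← hi]
  refine integral_congr_ae ?_
  filter_upwards [ae_norm_directions_eq_one n] with v hv
  simp only [PureStrategy.successProb_eq, bloch_meas_directionStrategy,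
    bloch_enc_directionStrategy, hL, unitVec_of_norm_eq_one (hv _)]

lemma SharedStrategy.integrable_successProb (R : SharedStrategy n) (x : Fin n → Bool) (i : Fin n) :
    Integrable (fun s => s.successProb x i) (R : Measure (PureStrategy n)) := by
  refine Integrable.of_bound (PureStrategy.measurable_successProb x i).aestronglyMeasurable 1
    (ae_of_all _ fun s => ?_)
  have h := norm_inner_le_norm (𝕜 := ℂ) (s.meas i (x i)) (s.enc x)
  rw [s.norm_enc, (s.orthonormal_meas i).1, mul_one] at h
  simpa [PureStrategy.successProb] using h

lemma expectedSuccess_randomStrategy (hn : 1 ≤ n) :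
    (randomStrategy n).expectedSuccess = 1 / 2 * (1 + 1 / n * meanDistance n) := by
  have hR := (randomStrategy n).integrable_successProb
  unfold SharedStrategy.expectedSuccess PureStrategy.averageSuccess
  rw [integral_const_mul,
    integral_finsetSum _ fun x _ => integrable_finsetSum _ fun i _ => hR x i]
  have h (x : Fin n → Bool) : ∫ s, ∑ i, PureStrategy.successProb s x i ∂(randomStrategy n :
      Measure (PureStrategy n)) = n * (1 / 2 * (1 + 1 / n * meanDistance n)) := by
    rw [integral_finsetSum _ fun i _ => hR x i]
    refine (Finset.sum_congr rfl fun i _ => successProb_randomStrategy x i).trans ?_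
    simp
  rw [Finset.sum_congr rfl fun x _ => h x]
  have : (n : ℝ) ≠ 0 := by positivity
  simp only [Finset.sum_const, Finset.card_univ, Fintype.card_pi, Fintype.card_bool,
    Finset.prod_const, Fintype.card_fin, nsmul_eq_mul, Nat.cast_pow, Nat.cast_ofNat]
  field_simp

lemma worstCaseSuccess_randomStrategy (hn : 1 ≤ n) :
    (randomStrategy n).worstCaseSuccess = 1 / 2 * (1 + 1 / n * meanDistance n) := by
  have : Nonempty (Fin n) := ⟨⟨0, hn⟩⟩
  simp only [SharedStrategy.worstCaseSuccess, successProb_randomStrategy, ciInf_const]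

lemma isEquivalent_meanDistance :
    Asymptotics.IsEquivalent atTop meanDistance
      (fun n : ℕ => 2 * √(2 * (n : ℝ) / (3 * Real.pi))) := by
  refine Asymptotics.isEquivalent_of_tendsto_one ?_
  have h := tendsto_meanDistance_div_sqrt.div_const (2 * √(2 / (3 * Real.pi)))
  rw [div_self (by positivity)] at h
  refine h.congr fun n => ?_
  rw [Pi.div_apply, show 2 * (n : ℝ) / (3 * Real.pi) = n * (2 / (3 * Real.pi)) by ring,
    Real.sqrt_mul n.cast_nonneg, inv_mul_eq_div, div_div]
  ring

end QRAC

end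

theorem theorem5 :
    ∃ R : ∀ n : ℕ, QRAC.SharedStrategy n,
      (∀ n, (R n).IsRandomMeasurement) ∧
      (∀ n, 1 ≤ n →
        (R n).worstCaseSuccess = (R n).expectedSuccess ∧
        (R n).expectedSuccess = 1 / 2 * (1 + 1 / (n : ℝ) * QRAC.meanDistance n)) ∧
      Asymptotics.IsEquivalent atTop QRAC.meanDistance
        (fun n : ℕ => 2 * √(2 * (n : ℝ) / (3 * Real.pi))) ∧
      Asymptotics.IsEquivalent atTop
        (fun n : ℕ => (R n).worstCaseSuccess - 1 / 2)
        (fun n : ℕ => √(2 / (3 * Real.pi * (n : ℝ)))) := by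
  refine ⟨QRAC.randomStrategy, QRAC.isRandomMeasurement_randomStrategy, fun n hn =>
    ⟨(QRAC.worstCaseSuccess_randomStrategy hn).trans
      (QRAC.expectedSuccess_randomStrategy hn).symm, QRAC.expectedSuccess_randomStrategy hn⟩,
    QRAC.isEquivalent_meanDistance, ?_⟩
  -- For `n ≥ 1` the advantage over `1/2` is exactly `d_n / (2n)`.
  have h := (Asymptotics.IsEquivalent.refl (u := fun n : ℕ => 1 / (2 * (n : ℝ)))
    (l := atTop)).mul QRAC.isEquivalent_meanDistance
  refine (h.congr_left ?_).congr_right ?_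
  · filter_upwards [eventually_ge_atTop 1] with n hn
    rw [QRAC.worstCaseSuccess_randomStrategy hn, Pi.mul_apply]
    ring
  · filter_upwards [eventually_ge_atTop 1] with n hn
    have hn' : (0 : ℝ) < n := by exact_mod_cast hn
    rw [Pi.mul_apply, show 2 / (3 * Real.pi * (n : ℝ)) = 2 * n / (3 * Real.pi) / n ^ 2 by
      field_simp, Real.sqrt_div (x := 2 * n / (3 * Real.pi)) (by positivity), Real.sqrt_sq hn'.le]
    field_simp
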